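/- Let $H$ be a Hopf algebra with bijective antipode over a field $\Bbbk$, and let $\mathcal C={}^H_H\mathcal{YD}$ be the category of left Yetter-Drinfeld modules over $H$, braided by $c_{X,Y}(x\otimes y)=x_{(-1)}\cdot y\otimes x_{(0)}$. Let $Q$ be an $\mathbb N_0^\theta$-graded Hopf algebra in $\mathcal C$ (all components are subobjects in $\mathcal C$ and all structure maps, including the antipode, are graded) such that the components $N_i=Q(\alpha_i)$, for the unit vectors $\alpha_1,\dots,\alpha_\theta$ of $\mathbb N_0^\theta$, are finite-dimensional and generate $Q$ as an algebra; that is, $(Q,(N_1,\dots,N_\theta))$ is a pre-Nichols system. Let $\Gamma$ be an abelian group with $\mathbb Z^\theta\subset\Gamma$, and regard $Q$ as $\Gamma$-graded by putting $Q(\gamma)=0$ for $\gamma\in\Gamma\setminus\mathbb N_0^\theta$. A left Yetter-Drinfeld module over $Q$ in $\mathcal C$ is an object $V\in\mathcal C$ with a left $Q$-module structure $\nu:Q\otimes V\to V$ and a left $Q$-comodule structure $\delta_V:V\to Q\otimes V$ in $\mathcal C$ such that $$(\mu_Q\otimes\nu)(\mathrm{id}_Q\otimes c_{Q,Q}\otimes\mathrm{id}_V)(\Delta_Q\otimes\delta_V)=(\mu_Q\otimes\mathrm{id}_V)(\mathrm{id}_Q\otimes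 c_{V,Q})(\delta_V\nu\otimes\mathrm{id}_Q)(\mathrm{id}_Q\otimes c_{Q,V})(\Delta_Q\otimes\mathrm{id}_V).$$ These form a category ${}^Q_Q\mathcal{YD}(\mathcal C)$, whose morphisms are the morphisms of $\mathcal C$ that are $Q$-linear and $Q$-colinear. An object (of $\mathcal C$ or of ${}^Q_Q\mathcal{YD}(\mathcal C)$) is irreducible if it is non-zero and has no subobjects other than $0$ and itself. Let $V=\bigoplus_{\gamma\in\Gamma}V(\gamma)$ be a $\Gamma$-graded object of ${}^Q_Q\mathcal{YD}(\mathcal C)$ (the $V(\gamma)$ are subobjects in $\mathcal C$, and $\nu$ and $\delta_V$ are graded), and let $\gamma_0\in\Gamma$ be such that $V(\gamma_0)$ generates $V$ as a $Q$-module and is irreducible in $\mathcal C$. Let $\pi_0:V\to V(\gamma_0)$ be the canonical projection and let $$f_V=(\mathrm{id}_Q\otimes\pi_0)\,\delta_V:\;V\longrightarrow Q\otimes V(\gamma_0)$$ be the Shapovalov morphism of $V$. Call a subobject $U$ of $V$ in ${}^Q_Q\mathcal{YD}(\mathcal C)$ graded if $U=\bigoplus_{\gamma\in\Gamma}(U\cap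 V(\gamma))$. Then: 1. $\ker f_V$ is a graded subobject of $V$ in ${}^Q_Q\mathcal{YD}(\mathcal C)$. 2. Every graded subobject $U\neq V$ of $V$ in ${}^Q_Q\mathcal{YD}(\mathcal C)$ satisfies $U\subset\ker f_V$. 3. $V$ is irreducible in ${}^Q_Q\mathcal{YD}(\mathcal C)$ if and only if $\ker f_V=0$. -/

import Mathlib

open scoped TensorProduct

noncomputable section

namespace YDNichols

universe u₀ u₁ u₂ u₃ u₄ u₅

/-! ### Actions and coactions -/

section Basic

variable {k : Type u₀} [Field k]

/-- A linear map `A ⊗ V → V` together with a linear map `V → A ⊗ V`. These are only the underlying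
data of an action and a coaction; the laws are `IsModule`, `IsComodule` and `YDCompat`. -/
structure ActCoact (k : Type u₀) [Field k] (A : Type u₁) [AddCommGroup A] [Module k A]
    (V : Type u₂) [AddCommGroup V] [Module k V] where
  act : A ⊗[k] V →ₗ[k] V
  coact : V →ₗ[k] A ⊗[k] V

/-- The map `id ⊗ c ⊗ id` for `c : B ⊗ C → C ⊗ B`. -/
def midBraid {A : Type u₁} {B : Type u₂} {C : Type u₃} {D : Type u₄}
    [AddCommGroup A] [Module k A] [AddCommGroup B] [Module k B]
    [AddCommGroup C] [Module k C] [AddCommGroup D] [Module k D]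
    (c : B ⊗[k] C →ₗ[k] C ⊗[k] B) :
    (A ⊗[k] B) ⊗[k] (C ⊗[k] D) →ₗ[k] (A ⊗[k] C) ⊗[k] (B ⊗[k] D) :=
  (TensorProduct.assoc k A C (B ⊗[k] D)).symm.toLinearMap ∘ₗ
    LinearMap.lTensor A
      ((TensorProduct.assoc k C B D).toLinearMap ∘ₗ
        LinearMap.rTensor D c ∘ₗ
        (TensorProduct.assoc k B C D).symm.toLinearMap) ∘ₗ
    (TensorProduct.assoc k A B (C ⊗[k] D)).toLinearMap

namespace ActCoact

section Structure

variable {A : Type u₁} [Ring A] [Algebra k A]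
variable {V : Type u₂} [AddCommGroup V] [Module k V]
variable {W : Type u₃} [AddCommGroup W] [Module k W]

/-- `act` makes `V` a left module over the algebra `A`. -/
def IsModule (X : ActCoact k A V) : Prop :=
  (∀ v : V, X.act (1 ⊗ₜ[k] v) = v) ∧
    ∀ (a b : A) (v : V), X.act ((a * b) ⊗ₜ[k] v) = X.act (a ⊗ₜ[k] X.act (b ⊗ₜ[k] v))

/-- `coact` makes `V` a left comodule over the coalgebra `A`. -/
def IsComodule [Coalgebra k A] (X : ActCoact k A V) : Prop :=
  (∀ v : V, LinearMap.rTensor V (Coalgebra.counit (R := k) (A := A)) (X.coact v) = 1 ⊗ₜ[k] v) ∧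
    (TensorProduct.assoc k A A V).toLinearMap ∘ₗ
        LinearMap.rTensor V (Coalgebra.comul (R := k) (A := A)) ∘ₗ X.coact =
      LinearMap.lTensor A X.coact ∘ₗ X.coact

/-- The compatibility condition of a left Yetter-Drinfeld module over `A`, with respect to given
braidings `cAA : A ⊗ A → A ⊗ A`, `cAV : A ⊗ V → V ⊗ A` and `cVA : V ⊗ A → A ⊗ V`:
`(μ ⊗ ν)(id ⊗ cAA ⊗ id)(Δ ⊗ δ) = (μ ⊗ id)(id ⊗ cVA)(δν ⊗ id)(id ⊗ cAV)(Δ ⊗ id)`. -/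
def YDCompat [Coalgebra k A] (X : ActCoact k A V)
    (cAA : A ⊗[k] A →ₗ[k] A ⊗[k] A) (cAV : A ⊗[k] V →ₗ[k] V ⊗[k] A)
    (cVA : V ⊗[k] A →ₗ[k] A ⊗[k] V) : Prop :=
  TensorProduct.map (LinearMap.mul' k A) X.act ∘ₗ midBraid cAA ∘ₗ
      TensorProduct.map (Coalgebra.comul (R := k) (A := A)) X.coact =
    LinearMap.rTensor V (LinearMap.mul' k A) ∘ₗ
      (TensorProduct.assoc k A A V).symm.toLinearMap ∘ₗ
      LinearMap.lTensor A cVA ∘ₗ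
      (TensorProduct.assoc k A V A).toLinearMap ∘ₗ
      LinearMap.rTensor A (X.coact ∘ₗ X.act) ∘ₗ
      (TensorProduct.assoc k A V A).symm.toLinearMap ∘ₗ
      LinearMap.lTensor A cAV ∘ₗ
      (TensorProduct.assoc k A A V).toLinearMap ∘ₗ
      LinearMap.rTensor V (Coalgebra.comul (R := k) (A := A))

/-- `f` commutes with the actions and with the coactions. -/
def IsHom (X : ActCoact k A V) (Y : ActCoact k A W) (f : V →ₗ[k] W) : Prop :=
  f ∘ₗ X.act = Y.act ∘ₗ LinearMap.lTensor A f ∧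
    Y.coact ∘ₗ f = LinearMap.lTensor A f ∘ₗ X.coact

/-- The subspace `U` is stable under the action and under the coaction,
i.e. `A · U ⊆ U` and `δ(U) ⊆ A ⊗ U`. -/
def IsSub (X : ActCoact k A V) (U : Submodule k V) : Prop :=
  (∀ (a : A), ∀ u ∈ U, X.act (a ⊗ₜ[k] u) ∈ U) ∧
    ∀ u ∈ U, X.coact u ∈ LinearMap.range (LinearMap.lTensor A U.subtype)

end Structure

/-! ### The category of Yetter-Drinfeld modules over a Hopf algebra `H` over `k` -/

section OverH

variable {H : Type u₁} [Ring H] [HopfAlgebra k H]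
variable {V : Type u₂} [AddCommGroup V] [Module k V]
variable {W : Type u₃} [AddCommGroup W] [Module k W]

/-- `V` is a left Yetter-Drinfeld module over the Hopf algebra `H`, i.e. an object of `𝒞`. -/
structure IsYD (X : ActCoact k H V) : Prop where
  isModule : X.IsModule
  isComodule : X.IsComodule
  compat : X.YDCompat (TensorProduct.comm k H H).toLinearMap
    (TensorProduct.comm k H V).toLinearMap (TensorProduct.comm k V H).toLinearMap

/-- The unit object `k`: trivial action and trivial coaction. -/
def unit (k : Type u₀) [Field k] (H : Type u₁) [Ring H] [HopfAlgebra k H] : ActCoact k H k where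
  act := (TensorProduct.lid k k).toLinearMap ∘ₗ
    LinearMap.rTensor k (Coalgebra.counit (R := k) (A := H))
  coact := TensorProduct.mk k H k 1

/-- The tensor product: diagonal action `h(v ⊗ w) = h₁v ⊗ h₂w` and diagonal coaction
`v ⊗ w ↦ v₋₁w₋₁ ⊗ v₀ ⊗ w₀`. -/
def tensor (X : ActCoact k H V) (Y : ActCoact k H W) : ActCoact k H (V ⊗[k] W) where
  act := TensorProduct.map X.act Y.act ∘ₗ
    (TensorProduct.tensorTensorTensorComm k H H V W).toLinearMap ∘ₗ
    LinearMap.rTensor (V ⊗[k] W) (Coalgebra.comul (R := k) (A := H))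
  coact := LinearMap.rTensor (V ⊗[k] W) (LinearMap.mul' k H) ∘ₗ
    (TensorProduct.tensorTensorTensorComm k H V H W).toLinearMap ∘ₗ
    TensorProduct.map X.coact Y.coact

/-- The braiding `c(v ⊗ w) = v₋₁ w ⊗ v₀` of `𝒞`. -/
def braiding (X : ActCoact k H V) (Y : ActCoact k H W) : V ⊗[k] W →ₗ[k] W ⊗[k] V :=
  LinearMap.rTensor V Y.act ∘ₗ
    (TensorProduct.assoc k H W V).symm.toLinearMap ∘ₗ
    LinearMap.lTensor H (TensorProduct.comm k V W).toLinearMap ∘ₗ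
    (TensorProduct.assoc k H V W).toLinearMap ∘ₗ
    LinearMap.rTensor W X.coact

end OverH

end ActCoact

end Basic

/-! ### Hopf algebras in `𝒞` and Yetter-Drinfeld modules over them -/

section Braided

variable {k : Type u₀} [Field k] {H : Type u₁} [Ring H] [HopfAlgebra k H]
variable {Q : Type u₂} [Ring Q] [Algebra k Q] [Coalgebra k Q]
variable {V : Type u₃} [AddCommGroup V] [Module k V]

/-- The algebra and coalgebra `Q`, with the `H`-action and `H`-coaction `XQ` and the map `S`, is a
Hopf algebra with antipode `S` in the category `𝒞` of Yetter-Drinfeld modules over `H`. -/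
structure IsHopfAlgebra (XQ : ActCoact k H Q) (S : Q →ₗ[k] Q) : Prop where
  isYD : XQ.IsYD
  unit_hom : (ActCoact.unit k H).IsHom XQ (Algebra.linearMap k Q)
  mul_hom : (XQ.tensor XQ).IsHom XQ (LinearMap.mul' k Q)
  counit_hom : XQ.IsHom (ActCoact.unit k H) (Coalgebra.counit (R := k) (A := Q))
  comul_hom : XQ.IsHom (XQ.tensor XQ) (Coalgebra.comul (R := k) (A := Q))
  antipode_hom : XQ.IsHom XQ S
  counit_one : Coalgebra.counit (R := k) (1 : Q) = 1
  counit_mul : ∀ x y : Q, Coalgebra.counit (R := k) (x * y) =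
    Coalgebra.counit (R := k) x * Coalgebra.counit (R := k) y
  comul_one : Coalgebra.comul (R := k) (1 : Q) = 1 ⊗ₜ[k] 1
  comul_mul : Coalgebra.comul (R := k) (A := Q) ∘ₗ LinearMap.mul' k Q =
    TensorProduct.map (LinearMap.mul' k Q) (LinearMap.mul' k Q) ∘ₗ
      midBraid (XQ.braiding XQ) ∘ₗ
      TensorProduct.map (Coalgebra.comul (R := k) (A := Q)) (Coalgebra.comul (R := k) (A := Q))
  antipode_left : LinearMap.mul' k Q ∘ₗ LinearMap.rTensor Q S ∘ₗ
    Coalgebra.comul (R := k) (A := Q) =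
      Algebra.linearMap k Q ∘ₗ Coalgebra.counit (R := k) (A := Q)
  antipode_right : LinearMap.mul' k Q ∘ₗ LinearMap.lTensor Q S ∘ₗ
    Coalgebra.comul (R := k) (A := Q) =
      Algebra.linearMap k Q ∘ₗ Coalgebra.counit (R := k) (A := Q)

/-- `V`, with its `H`-structure `XV` and its `Q`-structure `Y`, is a left Yetter-Drinfeld module
over the Hopf algebra `Q` in `𝒞`. -/
structure IsYDOver (XQ : ActCoact k H Q) (XV : ActCoact k H V) (Y : ActCoact k Q V) : Prop where
  isYD : XV.IsYD
  act_hom : (XQ.tensor XV).IsHom XV Y.act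
  coact_hom : XV.IsHom (XQ.tensor XV) Y.coact
  isModule : Y.IsModule
  isComodule : Y.IsComodule
  compat : Y.YDCompat (XQ.braiding XQ) (XQ.braiding XV) (XV.braiding XQ)

/-- The subspace `W` of `V` (meant for a subobject `W` of `V` in `𝒞`) is irreducible in `𝒞`:
it is non-zero and has no subobjects in `𝒞` besides `0` and `W`. -/
def IsIrreducibleComponent (XV : ActCoact k H V) (W : Submodule k V) : Prop :=
  W ≠ ⊥ ∧ ∀ U : Submodule k V, U ≤ W → XV.IsSub U → U = ⊥ ∨ U = W

/-- `U` is a subobject of `V` in the category of Yetter-Drinfeld modules over `Q` in `𝒞`. -/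
def IsSubobject (XV : ActCoact k H V) (Y : ActCoact k Q V) (U : Submodule k V) : Prop :=
  XV.IsSub U ∧ Y.IsSub U

/-- `V` is irreducible in the category of Yetter-Drinfeld modules over `Q` in `𝒞`. -/
def IsIrreducible (XV : ActCoact k H V) (Y : ActCoact k Q V) : Prop :=
  (⊤ : Submodule k V) ≠ ⊥ ∧
    ∀ U : Submodule k V, IsSubobject XV Y U → U = ⊥ ∨ U = ⊤

end Braided

/-! ### Gradings -/

section Graded

variable {k : Type u₀} [Field k] {Γ : Type u₅}

/-- A linear map is graded if it maps the component of degree `γ` into that of degree `γ`. -/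
def IsGradedMap {V : Type u₁} {W : Type u₂} [AddCommGroup V] [Module k V] [AddCommGroup W]
    [Module k W] (𝒱 : Γ → Submodule k V) (𝒲 : Γ → Submodule k W) (f : V →ₗ[k] W) : Prop :=
  ∀ γ, ∀ v ∈ 𝒱 γ, f v ∈ 𝒲 γ

/-- The grading of a tensor product: the component of degree `γ` is the sum of all
`𝒱(γ₁) ⊗ 𝒲(γ₂)` with `γ₁ + γ₂ = γ`. -/
def tensorGrading [AddCommMonoid Γ] {V : Type u₁} {W : Type u₂} [AddCommGroup V] [Module k V]
    [AddCommGroup W] [Module k W] (𝒱 : Γ → Submodule k V) (𝒲 : Γ → Submodule k W) (γ : Γ) :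
    Submodule k (V ⊗[k] W) :=
  ⨆ (γ₁ : Γ) (γ₂ : Γ) (_ : γ₁ + γ₂ = γ),
    LinearMap.range (TensorProduct.map (𝒱 γ₁).subtype (𝒲 γ₂).subtype)

/-- The trivial grading of the unit object `k`, concentrated in degree `0`. -/
def unitGrading (k : Type u₀) [Field k] (Γ : Type u₅) [AddCommMonoid Γ] (γ : Γ) :
    Submodule k k :=
  ⨆ (_ : γ = 0), ⊤

/-- Transport of a grading along a map of index sets; indices outside the image get `0`. -/
def gradingAlong {M : Type u₁} {Q : Type u₂} [AddCommGroup Q] [Module k Q] (f : M → Γ)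
    (𝒬 : M → Submodule k Q) (γ : Γ) : Submodule k Q :=
  ⨆ (n : M) (_ : f n = γ), 𝒬 n

/-- A grading of `V` as an object of `𝒞`: `V` is the direct sum of the subobjects `𝒱 γ`. -/
def IsGradedObject [DecidableEq Γ] {H : Type u₁} [Ring H] [HopfAlgebra k H] {V : Type u₂}
    [AddCommGroup V] [Module k V] (XV : ActCoact k H V) (𝒱 : Γ → Submodule k V) : Prop :=
  DirectSum.IsInternal 𝒱 ∧ ∀ γ, XV.IsSub (𝒱 γ)

/-- The canonical projection of a direct sum onto the component of degree `γ`. -/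
def projComponent [DecidableEq Γ] {V : Type u₁} [AddCommGroup V] [Module k V]
    (𝒱 : Γ → Submodule k V) (h : DirectSum.IsInternal 𝒱) (γ : Γ) : V →ₗ[k] 𝒱 γ :=
  DirectSum.component k Γ (fun γ => 𝒱 γ) γ ∘ₗ
    (LinearEquiv.ofBijective (DirectSum.coeLinearMap 𝒱) h).symm.toLinearMap

/-- A graded Hopf algebra in `𝒞`: all structure maps are graded. -/
structure IsGradedHopfAlgebra [AddCommMonoid Γ] [DecidableEq Γ]
    {H : Type u₁} [Ring H] [HopfAlgebra k H]
    {Q : Type u₂} [Ring Q] [Algebra k Q] [Coalgebra k Q]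
    (XQ : ActCoact k H Q) (S : Q →ₗ[k] Q) (𝒬 : Γ → Submodule k Q) : Prop where
  isHopfAlgebra : IsHopfAlgebra XQ S
  isGradedObject : IsGradedObject XQ 𝒬
  unit_graded : IsGradedMap (unitGrading k Γ) 𝒬 (Algebra.linearMap k Q)
  mul_graded : IsGradedMap (tensorGrading 𝒬 𝒬) 𝒬 (LinearMap.mul' k Q)
  counit_graded : IsGradedMap 𝒬 (unitGrading k Γ) (Coalgebra.counit (R := k) (A := Q))
  comul_graded : IsGradedMap 𝒬 (tensorGrading 𝒬 𝒬) (Coalgebra.comul (R := k) (A := Q))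
  antipode_graded : IsGradedMap 𝒬 𝒬 S

/-- A pre-Nichols system `(Q, (N₁, …, N_θ))`: `Q` is an `ℕ₀^θ`-graded Hopf algebra in `𝒞`,
`N i = Q(αᵢ)` is finite-dimensional for the unit vectors `αᵢ`, and the `N i` generate the algebra
`Q`. -/
structure IsPreNicholsSystem {θ : ℕ} {H : Type u₁} [Ring H] [HopfAlgebra k H]
    {Q : Type u₂} [Ring Q] [Algebra k Q] [Coalgebra k Q]
    (XQ : ActCoact k H Q) (S : Q →ₗ[k] Q) (𝒬 : (Fin θ → ℕ) → Submodule k Q)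
    (N : Fin θ → Submodule k Q) : Prop where
  isGradedHopfAlgebra : IsGradedHopfAlgebra XQ S 𝒬
  component_eq : ∀ i, 𝒬 (Pi.single i 1) = N i
  finite : ∀ i, Module.Finite k (N i)
  generates : Algebra.adjoin k (⋃ i, (N i : Set Q)) = ⊤

/-- The inclusion `ℕ₀^θ ⊆ ℤ^θ ⊆ Γ`, the second inclusion being `ι`. -/
def degreeMap {θ : ℕ} [AddCommGroup Γ] (ι : (Fin θ → ℤ) →+ Γ) (n : Fin θ → ℕ) : Γ :=
  ι fun i => (n i : ℤ)

/-- A `Γ`-graded Yetter-Drinfeld module over `Q` in `𝒞`, where `𝒬` is a `Γ`-grading of `Q`: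
the components are subobjects in `𝒞`, and the `Q`-action and the `Q`-coaction are graded. -/
structure IsGradedYD [AddCommMonoid Γ] [DecidableEq Γ] {H : Type u₁} [Ring H] [HopfAlgebra k H]
    {Q : Type u₂} [Ring Q] [Algebra k Q] [Coalgebra k Q]
    {V : Type u₃} [AddCommGroup V] [Module k V]
    (XQ : ActCoact k H Q) (𝒬 : Γ → Submodule k Q)
    (XV : ActCoact k H V) (Y : ActCoact k Q V) (𝒱 : Γ → Submodule k V) : Prop where
  isYDOver : IsYDOver XQ XV Y
  isGradedObject : IsGradedObject XV 𝒱
  act_graded : IsGradedMap (tensorGrading 𝒬 𝒱) 𝒱 Y.act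
  coact_graded : IsGradedMap 𝒱 (tensorGrading 𝒬 𝒱) Y.coact

/-- `V` is generated by the subspace `W` as a `Q`-module, i.e. `V` is the only `Q`-stable subspace
that contains `W`. -/
def IsGeneratedBy {Q : Type u₂} [Ring Q] [Algebra k Q] {V : Type u₃} [AddCommGroup V] [Module k V]
    (Y : ActCoact k Q V) (W : Submodule k V) : Prop :=
  ∀ U : Submodule k V, W ≤ U → (∀ (x : Q), ∀ u ∈ U, Y.act (x ⊗ₜ[k] u) ∈ U) → U = ⊤

/-- `U` is a graded subobject of `V`: a subobject in the category of Yetter-Drinfeld modules over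
`Q` in `𝒞` with `U = ⨁ γ, U ∩ V(γ)`. -/
def IsGradedSubobject {H : Type u₁} [Ring H] [HopfAlgebra k H]
    {Q : Type u₂} [Ring Q] [Algebra k Q] [Coalgebra k Q]
    {V : Type u₃} [AddCommGroup V] [Module k V]
    (XV : ActCoact k H V) (Y : ActCoact k Q V) (𝒱 : Γ → Submodule k V)
    (U : Submodule k V) : Prop :=
  IsSubobject XV Y U ∧ U = ⨆ γ, U ⊓ 𝒱 γ

/-- The Shapovalov morphism `f_V = (id_Q ⊗ π₀) δ_V : V → Q ⊗ V(γ₀)`, where `π₀` is the canonical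
projection of `V` onto `V(γ₀)`. -/
def shapovalov [DecidableEq Γ] {Q : Type u₂} [Ring Q] [Algebra k Q]
    {V : Type u₃} [AddCommGroup V] [Module k V] (Y : ActCoact k Q V) (𝒱 : Γ → Submodule k V)
    (h : DirectSum.IsInternal 𝒱) (γ₀ : Γ) : V →ₗ[k] Q ⊗[k] 𝒱 γ₀ :=
  LinearMap.lTensor Q (projComponent 𝒱 h γ₀) ∘ₗ Y.coact

end Graded

end YDNichols

end

/-! Write `π₀` for the projection onto `V(γ₀)` and `P = ker π₀`, the sum of all other components.
Then `K = ker f_V` consists of the `v` with `δ(v) ∈ Q ⊗ P`. Coassociativity makes `K` a subcomodule,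
the counit gives `K ⊆ P`, and every subcomodule inside `P` lies in `K`. Since `δ` is a morphism in
`𝒞` and `P` is a subobject in `𝒞`, so is `K`.

The harder point is `Q · K ⊆ K`. It suffices to act by the generators in `N i`, which are primitive
because `Q` is connected (`component_zero_le`, `comul_eq`). For primitive `x` the Yetter-Drinfeld
condition expresses `δ(x · v)` through terms in `Q ⊗ (Q · K)` and `Q ⊗ K`
(`coact_act_mem_of_primitive`). Both lie in `Q ⊗ P`, because `P` is `Q`-stable: `V` is generated by
`V(γ₀)`, hence lives in the degrees `n + γ₀` with `n ∈ ℕ^θ`, and acting by `Q` never lowers `n`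
(`act_mem_ker_homogProj`).

A subobject meeting `V(γ₀)` non-trivially contains `V(γ₀)` by irreducibility, hence is `V`. A proper
graded subobject therefore lies in `P`, so in `K`. For the irreducibility criterion arbitrary
subobjects `U` must be treated: if `K = 0`, slicing the coaction of a non-zero `u ∈ U` in a maximal
degree of `Q` produces a non-zero element of `U ∩ V(γ₀)` (`inf_ne_bot_of_ker_shapovalov_eq_bot`). -/

open scoped TensorProduct

noncomputable section

namespace YDNichols

universe u₀ u₁ u₂ u₃ u₄ u₅

/-! ### Slices of tensors by linear forms, and membership in `A ⊗ U` -/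

section Slices

variable {k : Type u₀} [Field k] {A : Type u₁} [AddCommGroup A] [Module k A]
variable {V : Type u₂} [AddCommGroup V] [Module k V]

/-- The map `φ ⊗ id : A ⊗ V → V` for a linear form `φ` on `A`. -/
def slice (φ : A →ₗ[k] k) : A ⊗[k] V →ₗ[k] V :=
  (TensorProduct.lid k V).toLinearMap ∘ₗ LinearMap.rTensor V φ

@[simp]
theorem slice_tmul (φ : A →ₗ[k] k) (a : A) (v : V) : slice φ (a ⊗ₜ[k] v) = φ a • v := by
  simp [slice]

theorem slice_lTensor {W : Type u₃} [AddCommGroup W] [Module k W] (φ : A →ₗ[k] k)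
    (g : V →ₗ[k] W) (t : A ⊗[k] V) : slice φ (LinearMap.lTensor A g t) = g (slice φ t) := by
  induction t with
  | zero => simp
  | tmul a v => simp
  | add x y hx hy => simp [hx, hy]

/-- A basis of `A` identifies `A ⊗ V` with finitely supported families in `V`, and the slices by the
coordinate forms are the entries. -/
theorem eq_zero_of_slice_eq_zero (t : A ⊗[k] V) (h : ∀ φ : A →ₗ[k] k, slice φ t = 0) :
    t = 0 := by
  classical
  let b := Module.Basis.ofVectorSpace k A
  apply (TensorProduct.equivFinsuppOfBasisLeft (N := V) b).injective
  ext i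
  rw [map_zero, Finsupp.zero_apply, ← h (b.coord i),
    TensorProduct.equivFinsuppOfBasisLeft_apply]
  rfl

/-- By right exactness, `t` comes from `A ⊗ U` iff its image in `A ⊗ (V / U)` vanishes, which slices
detect. This criterion turns statements about subcomodules into statements about vectors of `V`. -/
theorem mem_range_lTensor_iff (U : Submodule k V) (t : A ⊗[k] V) :
    t ∈ LinearMap.range (LinearMap.lTensor A U.subtype) ↔ ∀ φ : A →ₗ[k] k, slice φ t ∈ U := by
  constructor
  · rintro ⟨s, rfl⟩ φ
    rw [slice_lTensor]
    exact (slice φ s).2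
  · intro h
    refine (lTensor_exact A (f := U.subtype) (g := U.mkQ)
      (LinearMap.exact_subtype_mkQ U) U.mkQ_surjective t).1 ?_
    refine eq_zero_of_slice_eq_zero _ fun φ => ?_
    rw [slice_lTensor]
    simpa using h φ

theorem tmul_mem_range_lTensor {U : Submodule k V} (a : A) {u : V} (hu : u ∈ U) :
    a ⊗ₜ[k] u ∈ LinearMap.range (LinearMap.lTensor A U.subtype) :=
  ⟨a ⊗ₜ ⟨u, hu⟩, by simp⟩

/-- To check that a linear map sends `A ⊗ U` into a subspace it suffices to consider pure
tensors. -/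
theorem map_mem_of_tmul {X : Type u₃} [AddCommGroup X] [Module k X] {U : Submodule k V}
    (g : A ⊗[k] V →ₗ[k] X) (T : Submodule k X) (h : ∀ a, ∀ u ∈ U, g (a ⊗ₜ u) ∈ T) {t : A ⊗[k] V}
    (ht : t ∈ LinearMap.range (LinearMap.lTensor A U.subtype)) : g t ∈ T := by
  obtain ⟨s, rfl⟩ := ht
  induction s with
  | zero => simp
  | tmul a v => simpa using h a v v.2
  | add x y hx hy => simpa using T.add_mem hx hy

/-- To check that a linear map on a tensor product takes values in a subspace it suffices to
consider pure tensors. -/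
theorem map_mem_of_forall_tmul {X : Type u₃} [AddCommGroup X] [Module k X]
    (g : A ⊗[k] V →ₗ[k] X) (T : Submodule k X) (h : ∀ a u, g (a ⊗ₜ u) ∈ T) (t : A ⊗[k] V) :
    g t ∈ T := by
  induction t with
  | zero => simp
  | tmul a v => exact h a v
  | add x y hx hy => simpa using T.add_mem hx hy

theorem range_lTensor_mono {U U' : Submodule k V} (h : U ≤ U') :
    LinearMap.range (LinearMap.lTensor A U.subtype) ≤
      LinearMap.range (LinearMap.lTensor A U'.subtype) := fun t ht => by
  rw [mem_range_lTensor_iff] at ht ⊢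
  exact fun φ => h (ht φ)

end Slices

theorem ActCoact.IsSub.inf {k : Type u₀} [Field k] {A : Type u₁} [Ring A] [Algebra k A]
    {V : Type u₂} [AddCommGroup V] [Module k V] {X : ActCoact k A V} {U W : Submodule k V}
    (hU : X.IsSub U) (hW : X.IsSub W) : X.IsSub (U ⊓ W) := by
  refine ⟨fun a u hu => ⟨hU.1 a u hu.1, hW.1 a u hu.2⟩, fun u hu => ?_⟩
  have h1 := hU.2 u hu.1
  have h2 := hW.2 u hu.2
  rw [mem_range_lTensor_iff] at h1 h2 ⊢
  exact fun φ => ⟨h1 φ, h2 φ⟩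

/-! ### Projections onto homogeneous components -/

section Projections

variable {k : Type u₀} [Field k] {Γ : Type u₅} [DecidableEq Γ]
variable {V : Type u₂} [AddCommGroup V] [Module k V] {𝒱 : Γ → Submodule k V}

/-- The projection onto the component of degree `γ`, as an endomorphism. -/
def homogProj (h : DirectSum.IsInternal 𝒱) (γ : Γ) : V →ₗ[k] V :=
  (𝒱 γ).subtype ∘ₗ projComponent 𝒱 h γ

variable (h : DirectSum.IsInternal 𝒱)

theorem homogProj_mem (γ : Γ) (v : V) : homogProj h γ v ∈ 𝒱 γ :=
  (projComponent 𝒱 h γ v).2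

theorem homogProj_eq_zero_iff (γ : Γ) (v : V) :
    homogProj h γ v = 0 ↔ projComponent 𝒱 h γ v = 0 := by
  simp [homogProj]

theorem projComponent_coeLinearMap (γ : Γ) (d : DirectSum Γ fun γ => 𝒱 γ) :
    projComponent 𝒱 h γ (DirectSum.coeLinearMap 𝒱 d) = d γ := by
  have : (LinearEquiv.ofBijective (DirectSum.coeLinearMap 𝒱) h).symm
      (DirectSum.coeLinearMap 𝒱 d) = d :=
    (LinearEquiv.ofBijective (DirectSum.coeLinearMap 𝒱) h).symm_apply_apply d
  simp only [projComponent, LinearMap.comp_apply, LinearEquiv.coe_coe]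
  exact congrArg (fun d : DirectSum Γ fun γ => 𝒱 γ => d γ) this

theorem homogProj_coeLinearMap (γ : Γ) (d : DirectSum Γ fun γ => 𝒱 γ) :
    homogProj h γ (DirectSum.coeLinearMap 𝒱 d) = d γ := by
  rw [homogProj, LinearMap.comp_apply, projComponent_coeLinearMap]
  rfl

theorem homogProj_of_mem {γ : Γ} {v : V} (hv : v ∈ 𝒱 γ) : homogProj h γ v = v := by
  have := homogProj_coeLinearMap h γ (DirectSum.lof k Γ (fun γ => 𝒱 γ) γ ⟨v, hv⟩)
  rwa [DirectSum.coeLinearMap_lof, DirectSum.lof_apply] at this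

theorem homogProj_of_mem_ne {γ γ' : Γ} {v : V} (hv : v ∈ 𝒱 γ') (hne : γ' ≠ γ) :
    homogProj h γ v = 0 := by
  have := homogProj_coeLinearMap h γ (DirectSum.lof k Γ (fun γ => 𝒱 γ) γ' ⟨v, hv⟩)
  rw [DirectSum.coeLinearMap_lof, DirectSum.lof_eq_of, DirectSum.of_eq_of_ne _ _ _ hne.symm] at this
  exact this

theorem exists_finset_sum_homogProj (v : V) :
    ∃ s : Finset Γ, (∀ γ, homogProj h γ v ≠ 0 → γ ∈ s) ∧ v = ∑ γ ∈ s, homogProj h γ v := by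
  classical
  obtain ⟨d, rfl⟩ := h.2 v
  refine ⟨DFinsupp.support d, fun γ hγ => ?_, ?_⟩
  · rw [DFinsupp.mem_support_iff]
    intro h0
    refine hγ ?_
    erw [homogProj_coeLinearMap, h0]
    rfl
  · refine (DirectSum.coeLinearMap_eq_dfinsuppSum 𝒱 d).trans (Finset.sum_congr rfl fun γ _ => ?_)
    exact (homogProj_coeLinearMap h γ d).symm

theorem mem_of_homogProj_mem (U : Submodule k V) {v : V} (hv : ∀ γ, homogProj h γ v ∈ U) :
    v ∈ U := by
  obtain ⟨s, -, hs⟩ := exists_finset_sum_homogProj h v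
  rw [hs]
  exact U.sum_mem fun γ _ => hv γ

include h in
theorem induction_homogeneous (U : Submodule k V) (hU : ∀ γ, 𝒱 γ ≤ U) (v : V) : v ∈ U :=
  mem_of_homogProj_mem h U fun γ => hU γ (homogProj_mem h γ v)

theorem homogProj_eq_self {γ₀ : Γ} {v : V} (hv : ∀ γ, γ ≠ γ₀ → homogProj h γ v = 0) :
    homogProj h γ₀ v = v := by
  refine homogProj_of_mem h (mem_of_homogProj_mem h _ fun γ => ?_)
  by_cases hγ : γ = γ₀
  · subst hγ
    exact homogProj_mem h γ v
  · rw [hv γ hγ]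
    exact zero_mem _

end Projections

theorem tmul_mem_tensorGrading {k : Type u₀} [Field k] {Γ : Type u₅} [AddCommMonoid Γ]
    {V : Type u₁} {W : Type u₂} [AddCommGroup V] [Module k V] [AddCommGroup W] [Module k W]
    {𝒱 : Γ → Submodule k V} {𝒲 : Γ → Submodule k W} {γ₁ γ₂ : Γ} {v : V} {w : W}
    (hv : v ∈ 𝒱 γ₁) (hw : w ∈ 𝒲 γ₂) : v ⊗ₜ[k] w ∈ tensorGrading 𝒱 𝒲 (γ₁ + γ₂) :=
  le_iSup₂_of_le (f := fun γ₁' γ₂' => ⨆ (_ : γ₁' + γ₂' = γ₁ + γ₂),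
      LinearMap.range (TensorProduct.map (𝒱 γ₁').subtype (𝒲 γ₂').subtype)) γ₁ γ₂
    (le_iSup (fun _ : γ₁ + γ₂ = γ₁ + γ₂ =>
      LinearMap.range (TensorProduct.map (𝒱 γ₁).subtype (𝒲 γ₂).subtype)) rfl)
    ⟨⟨v, hv⟩ ⊗ₜ ⟨w, hw⟩, by simp⟩

theorem tensorGrading_le {k : Type u₀} [Field k] {Γ : Type u₅} [AddCommMonoid Γ]
    {V : Type u₁} {W : Type u₂} [AddCommGroup V] [Module k V] [AddCommGroup W] [Module k W]
    {𝒱 : Γ → Submodule k V} {𝒲 : Γ → Submodule k W} {γ : Γ} {T : Submodule k (V ⊗[k] W)}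
    (h : ∀ γ₁ γ₂, γ₁ + γ₂ = γ → ∀ v ∈ 𝒱 γ₁, ∀ w ∈ 𝒲 γ₂, v ⊗ₜ w ∈ T) :
    tensorGrading 𝒱 𝒲 γ ≤ T := by
  refine iSup_le fun γ₁ => iSup_le fun γ₂ => iSup_le fun hγ => ?_
  rintro _ ⟨t, rfl⟩
  refine map_mem_of_forall_tmul _ T (fun a u => ?_) t
  simpa using h γ₁ γ₂ hγ a a.2 u u.2

/-! ### Connectedness and primitive generators of a pre-Nichols system -/

section PreNichols

variable {k : Type u₀} [Field k] {H : Type u₁} [Ring H] [HopfAlgebra k H]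
variable {Q : Type u₂} [Ring Q] [Algebra k Q] [Coalgebra k Q] {θ : ℕ}
variable {XQ : ActCoact k H Q} {S : Q →ₗ[k] Q} {𝒬 : (Fin θ → ℕ) → Submodule k Q}
variable {N : Fin θ → Submodule k Q}

namespace IsGradedHopfAlgebra

variable (hQ : IsGradedHopfAlgebra XQ S 𝒬)

include hQ

theorem one_mem : (1 : Q) ∈ 𝒬 0 := by
  have := hQ.unit_graded 0 1 (by simp [unitGrading])
  simpa using this

theorem mul_mem {m n : Fin θ → ℕ} {x y : Q} (hx : x ∈ 𝒬 m) (hy : y ∈ 𝒬 n) :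
    x * y ∈ 𝒬 (m + n) := by
  simpa using hQ.mul_graded _ _ (tmul_mem_tensorGrading hx hy)

theorem counit_eq_zero {n : Fin θ → ℕ} (hn : n ≠ 0) {x : Q} (hx : x ∈ 𝒬 n) :
    Coalgebra.counit (R := k) x = 0 := by
  simpa [unitGrading, hn] using hQ.counit_graded n x hx

end IsGradedHopfAlgebra

namespace IsPreNicholsSystem

variable (hQ : IsPreNicholsSystem XQ S 𝒬 N)

include hQ

/-- A pre-Nichols system is connected. -/
theorem component_zero_le : 𝒬 0 ≤ Submodule.span k {1} := by
  have hG := hQ.isGradedHopfAlgebra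
  have hint := hG.isGradedObject.1
  -- The augmentation ideal. It is closed under products because non-zero degrees in `ℕ^θ` cannot
  -- cancel.
  let T : Submodule k Q := ⨆ n : {n : Fin θ → ℕ // n ≠ 0}, 𝒬 n
  have hT : ∀ n : Fin θ → ℕ, n ≠ 0 → 𝒬 n ≤ T := fun n hn => le_iSup_of_le ⟨n, hn⟩ le_rfl
  have hTT : ∀ x ∈ T, ∀ y ∈ T, x * y ∈ T := by
    intro x hx y hy
    induction hx using Submodule.iSup_induction' with
    | mem m x hx =>
      induction hy using Submodule.iSup_induction' with
      | mem n y hy =>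
        refine hT (m + n) ?_ (hG.mul_mem hx hy)
        intro h0
        exact m.2 (by ext j; have := congrFun h0 j; simp at this ⊢; omega)
      | zero => simp
      | add y y' _ _ hy hy' => rw [mul_add]; exact T.add_mem hy hy'
    | zero => simp
    | add x x' _ _ hx hx' => rw [add_mul]; exact T.add_mem hx hx'
  -- `Q = k · 1 + T`, since the generators have non-zero degree and so lie in `T`.
  have key : ∀ x : Q, ∃ c : k, x - algebraMap k Q c ∈ T := by
    intro x
    have hx : x ∈ Algebra.adjoin k (⋃ i, (N i : Set Q)) := by rw [hQ.generates]; trivial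
    induction hx using Algebra.adjoin_induction with
    | mem x hx =>
      obtain ⟨i, hi⟩ := Set.mem_iUnion.1 hx
      refine ⟨0, ?_⟩
      rw [map_zero, sub_zero]
      rw [← hQ.component_eq] at hi
      exact hT _ (by simp) hi
    | algebraMap c => exact ⟨c, by simp⟩
    | add x y _ _ hx hy =>
      obtain ⟨c, hc⟩ := hx
      obtain ⟨d, hd⟩ := hy
      refine ⟨c + d, ?_⟩
      have := T.add_mem hc hd
      rwa [map_add, add_sub_add_comm]
    | mul x y _ _ hx hy =>
      obtain ⟨c, hc⟩ := hx
      obtain ⟨d, hd⟩ := hy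
      refine ⟨c * d, ?_⟩
      -- `xy - cd = (x - c)(y - d) + c(y - d) + d(x - c)`.
      have h1 := T.add_mem (hTT _ hc _ hd)
        (T.add_mem (T.smul_mem c hd) (T.smul_mem d hc))
      convert h1 using 1
      rw [Algebra.smul_def, Algebra.smul_def, map_mul, Algebra.commutes d (x - _)]
      noncomm_ring
  intro x hx
  obtain ⟨c, hc⟩ := key x
  have h0 : x - algebraMap k Q c ∈ 𝒬 0 := by
    refine Submodule.sub_mem _ hx ?_
    rw [Algebra.algebraMap_eq_smul_one]
    exact Submodule.smul_mem _ _ hG.one_mem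
  have hle : T ≤ LinearMap.ker (homogProj hint 0) := by
    refine iSup_le fun n y hy => ?_
    exact homogProj_of_mem_ne hint hy n.2
  have h1 : x - algebraMap k Q c = 0 := by
    rw [← homogProj_of_mem hint h0]
    exact hle hc
  rw [sub_eq_zero.1 h1, Algebra.algebraMap_eq_smul_one]
  exact Submodule.smul_mem _ _ (Submodule.mem_span_singleton_self 1)

/-- The elements of degree `αᵢ` are primitive. -/
theorem comul_eq {i : Fin θ} {x : Q} (hx : x ∈ N i) :
    Coalgebra.comul (R := k) x = x ⊗ₜ[k] 1 + 1 ⊗ₜ[k] x := by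
  have hG := hQ.isGradedHopfAlgebra
  rw [← hQ.component_eq] at hx
  let T : Submodule k (Q ⊗[k] Q) :=
    (𝒬 (Pi.single i 1)).map ((TensorProduct.mk k Q Q).flip 1) ⊔
      (𝒬 (Pi.single i 1)).map (TensorProduct.mk k Q Q 1)
  have hT : Coalgebra.comul (R := k) x ∈ T := by
    refine tensorGrading_le (fun m n hmn y hy z hz => ?_) (hG.comul_graded _ x hx)
    -- A unit vector is not a sum of two non-zero vectors of `ℕ^θ`. With connectedness this leaves
    -- only `a ⊗ 1 + 1 ⊗ b` for the coproduct.
    have hor : m = 0 ∨ n = 0 := by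
      by_contra! hne
      obtain ⟨h1, h2⟩ := hne
      have hz : ∀ j, j ≠ i → m j = 0 ∧ n j = 0 := by
        intro j hj
        have := congrFun hmn j
        simp [hj] at this
        exact this
      have hi := congrFun hmn i
      simp at hi
      have h1' : m i ≠ 0 := fun h => h1 (by
        ext j
        by_cases hj : j = i
        · rw [hj]; exact h
        · exact (hz j hj).1)
      have h2' : n i ≠ 0 := fun h => h2 (by
        ext j
        by_cases hj : j = i
        · rw [hj]; exact h
        · exact (hz j hj).2)
      omega
    rcases hor with rfl | rfl
    · rw [zero_add] at hmn
      subst hmn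
      obtain ⟨c, rfl⟩ := Submodule.mem_span_singleton.1 (hQ.component_zero_le hy)
      refine Submodule.mem_sup_right ⟨c • z, Submodule.smul_mem _ c hz, ?_⟩
      simp [TensorProduct.smul_tmul']
    · rw [add_zero] at hmn
      subst hmn
      obtain ⟨c, rfl⟩ := Submodule.mem_span_singleton.1 (hQ.component_zero_le hz)
      refine Submodule.mem_sup_left ⟨c • y, Submodule.smul_mem _ c hy, ?_⟩
      simp [TensorProduct.smul_tmul']
  obtain ⟨_, ⟨a, ha, rfl⟩, _, ⟨b, hb, rfl⟩, hab⟩ := Submodule.mem_sup.1 hT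
  have hne : (Pi.single i 1 : Fin θ → ℕ) ≠ 0 := by simp
  have hεa := hG.counit_eq_zero hne ha
  have hεb := hG.counit_eq_zero hne hb
  -- The counit kills `a` and `b`, so the two counit axioms read off `b = x` and `a = x`.
  have h1 := Coalgebra.rTensor_counit_comul (R := k) x
  have h2 := Coalgebra.lTensor_counit_comul (R := k) x
  rw [← hab] at h1 h2
  simp [hεa, hG.isHopfAlgebra.counit_one] at h1
  simp [hεb, hG.isHopfAlgebra.counit_one] at h2
  have h1' : b = x := by simpa using congrArg (TensorProduct.lid k Q) h1
  have h2' : a = x := by simpa using congrArg (TensorProduct.rid k Q) h2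
  rw [← hab, h1', h2']
  rfl

end IsPreNicholsSystem

end PreNichols

/-! ### Homogeneous projections as morphisms in `𝒞` -/

section GradedObject

variable {k : Type u₀} [Field k] {H : Type u₁} [Ring H] [HopfAlgebra k H]
variable {V : Type u₂} [AddCommGroup V] [Module k V] {Γ : Type u₅} [DecidableEq Γ]
variable {XV : ActCoact k H V} {𝒱 : Γ → Submodule k V}

namespace IsGradedObject

variable (hV : IsGradedObject XV 𝒱)

theorem homogProj_act (γ : Γ) (a : H) (v : V) :
    homogProj hV.1 γ (XV.act (a ⊗ₜ v)) = XV.act (a ⊗ₜ homogProj hV.1 γ v) := by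
  let T : Submodule k V := LinearMap.eqLocus
    (homogProj hV.1 γ ∘ₗ XV.act ∘ₗ TensorProduct.mk k H V a)
    (XV.act ∘ₗ TensorProduct.mk k H V a ∘ₗ homogProj hV.1 γ)
  refine induction_homogeneous hV.1 T (fun γ' v hv => ?_) v
  change homogProj hV.1 γ (XV.act (a ⊗ₜ v)) = XV.act (a ⊗ₜ homogProj hV.1 γ v)
  have hav := (hV.2 γ').1 a v hv
  by_cases h : γ' = γ
  · subst h
    rw [homogProj_of_mem _ hv, homogProj_of_mem _ hav]
  · rw [homogProj_of_mem_ne _ hv h, homogProj_of_mem_ne _ hav h]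
    simp

/-- Colinearity of the projection over `H`, written with slices; by linearity it is enough to take
`v` homogeneous. -/
theorem slice_coact_homogProj (γ : Γ) (φ : H →ₗ[k] k) (v : V) :
    slice φ (XV.coact (homogProj hV.1 γ v)) = homogProj hV.1 γ (slice φ (XV.coact v)) := by
  let T : Submodule k V := LinearMap.eqLocus
    (slice φ ∘ₗ XV.coact ∘ₗ homogProj hV.1 γ)
    (homogProj hV.1 γ ∘ₗ slice φ ∘ₗ XV.coact)
  refine induction_homogeneous hV.1 T (fun γ' v hv => ?_) v
  change slice φ (XV.coact (homogProj hV.1 γ v)) = homogProj hV.1 γ (slice φ (XV.coact v))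
  have hav := (mem_range_lTensor_iff _ _).1 ((hV.2 γ').2 v hv) φ
  by_cases h : γ' = γ
  · subst h
    rw [homogProj_of_mem _ hv, homogProj_of_mem _ hav]
  · rw [homogProj_of_mem_ne _ hv h, homogProj_of_mem_ne _ hav h]
    simp

theorem isSub_ker_homogProj (γ : Γ) : XV.IsSub (LinearMap.ker (homogProj hV.1 γ)) := by
  refine ⟨fun a u hu => ?_, fun u hu => ?_⟩
  · rw [LinearMap.mem_ker] at hu ⊢
    rw [hV.homogProj_act, hu, TensorProduct.tmul_zero, map_zero]
  · rw [mem_range_lTensor_iff]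
    intro φ
    rw [LinearMap.mem_ker] at hu ⊢
    rw [← hV.slice_coact_homogProj, hu, map_zero, map_zero]

end IsGradedObject

end GradedObject

/-! ### The kernel of the Shapovalov morphism -/

section Kernel

variable {k : Type u₀} [Field k] {Γ : Type u₅} [DecidableEq Γ]
variable {Q : Type u₂} [Ring Q] [Algebra k Q]
variable {V : Type u₃} [AddCommGroup V] [Module k V] {Y : ActCoact k Q V}
variable {𝒱 : Γ → Submodule k V}

theorem mem_ker_shapovalov_iff (h : DirectSum.IsInternal 𝒱) (γ₀ : Γ) (v : V) :
    v ∈ LinearMap.ker (shapovalov Y 𝒱 h γ₀) ↔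
      ∀ φ : Q →ₗ[k] k, homogProj h γ₀ (slice φ (Y.coact v)) = 0 := by
  rw [LinearMap.mem_ker]
  constructor
  · intro hv φ
    rw [homogProj_eq_zero_iff, ← slice_lTensor]
    exact (congrArg (slice φ) hv).trans (map_zero _)
  · intro hv
    refine eq_zero_of_slice_eq_zero _ fun φ => ?_
    rw [shapovalov, LinearMap.comp_apply, slice_lTensor, ← homogProj_eq_zero_iff]
    exact hv φ

/-- The working description of the kernel: each closure property of it becomes a statement about `Q
⊗ ker π₀`. -/
theorem mem_ker_shapovalov_iff_coact_mem (h : DirectSum.IsInternal 𝒱) (γ₀ : Γ) (v : V) :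
    v ∈ LinearMap.ker (shapovalov Y 𝒱 h γ₀) ↔ Y.coact v ∈
      LinearMap.range (LinearMap.lTensor Q (LinearMap.ker (homogProj h γ₀)).subtype) := by
  rw [mem_ker_shapovalov_iff, mem_range_lTensor_iff]
  rfl

/-- The counit shows that the Shapovalov morphism recovers the projection onto `V(γ₀)`. -/
theorem homogProj_eq_zero_of_mem_ker [Coalgebra k Q] (hY : Y.IsComodule)
    (h : DirectSum.IsInternal 𝒱) {γ₀ : Γ} {v : V}
    (hv : v ∈ LinearMap.ker (shapovalov Y 𝒱 h γ₀)) : homogProj h γ₀ v = 0 := by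
  have h1 := (mem_ker_shapovalov_iff h γ₀ v).1 hv (Coalgebra.counit (R := k) (A := Q))
  have h2 : slice (Coalgebra.counit (R := k) (A := Q)) (Y.coact v) = v := by
    rw [slice, LinearMap.comp_apply, hY.1 v]
    simp
  rwa [h2] at h1

/-- A subcomodule contained in `ker π₀` is contained in the kernel of the Shapovalov morphism. -/
theorem le_ker_shapovalov (h : DirectSum.IsInternal 𝒱) {γ₀ : Γ} {U : Submodule k V}
    (hU : Y.IsSub U) (hle : U ≤ LinearMap.ker (homogProj h γ₀)) :
    U ≤ LinearMap.ker (shapovalov Y 𝒱 h γ₀) := fun u hu => by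
  rw [mem_ker_shapovalov_iff_coact_mem]
  exact range_lTensor_mono hle (hU.2 u hu)

end Kernel

/-! ### Transport of degrees from `ℕ^θ` to `Γ` -/

section Degrees

variable {k : Type u₀} [Field k] {Q : Type u₂} [Ring Q] [Algebra k Q] {θ : ℕ}
variable {𝒬 : (Fin θ → ℕ) → Submodule k Q} {Γ : Type u₅}

theorem le_gradingAlong (f : (Fin θ → ℕ) → Γ) (n : Fin θ → ℕ) : 𝒬 n ≤ gradingAlong f 𝒬 (f n) :=
  le_iSup₂ (f := fun (m : Fin θ → ℕ) (_ : f m = f n) => 𝒬 m) n rfl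

/-- Stability under the action may be checked on homogeneous elements of `Q`. -/
theorem act_mem_of_homogeneous (hQ : DirectSum.IsInternal 𝒬)
    {V : Type u₃} [AddCommGroup V] [Module k V]
    {Y : ActCoact k Q V} {U : Submodule k V} {v : V} (h : ∀ n, ∀ x ∈ 𝒬 n, Y.act (x ⊗ₜ v) ∈ U) (x : Q) :
    Y.act (x ⊗ₜ v) ∈ U :=
  induction_homogeneous hQ (U.comap (Y.act ∘ₗ (TensorProduct.mk k Q V).flip v)) h x

variable [AddCommGroup Γ] {ι : (Fin θ → ℤ) →+ Γ}

theorem degreeMap_add (ι : (Fin θ → ℤ) →+ Γ) (m n : Fin θ → ℕ) :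
    degreeMap ι (m + n) = degreeMap ι m + degreeMap ι n := by
  rw [degreeMap, degreeMap, degreeMap, ← map_add]
  congr 1

theorem degreeMap_zero (ι : (Fin θ → ℤ) →+ Γ) : degreeMap ι (0 : Fin θ → ℕ) = 0 :=
  map_zero ι

theorem degreeMap_injective (hι : Function.Injective ι) : Function.Injective (degreeMap ι) := by
  intro m n h
  ext j
  exact_mod_cast congrFun (hι h) j

end Degrees

/-! ### Degree arguments in graded Yetter-Drinfeld modules -/

section GradedYD

variable {k : Type u₀} [Field k] {H : Type u₁} [Ring H] [HopfAlgebra k H]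
variable {Q : Type u₂} [Ring Q] [Algebra k Q] [Coalgebra k Q] {θ : ℕ}
variable {XQ : ActCoact k H Q} {𝒬 : (Fin θ → ℕ) → Submodule k Q}
variable {Γ : Type u₅} [AddCommGroup Γ] [DecidableEq Γ] {ι : (Fin θ → ℤ) →+ Γ}
variable {V : Type u₃} [AddCommGroup V] [Module k V]
variable {XV : ActCoact k H V} {Y : ActCoact k Q V} {𝒱 : Γ → Submodule k V}

namespace IsGradedYD

variable (hV : IsGradedYD XQ (gradingAlong (degreeMap ι) 𝒬) XV Y 𝒱)

include hV in
theorem act_mem {n : Fin θ → ℕ} {γ : Γ} {x : Q} {v : V} (hx : x ∈ 𝒬 n) (hv : v ∈ 𝒱 γ) :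
    Y.act (x ⊗ₜ v) ∈ 𝒱 (degreeMap ι n + γ) :=
  hV.act_graded _ _ (tmul_mem_tensorGrading (le_gradingAlong _ n hx) hv)

-- Every component of `Q` in a degree of `Γ` is a sum of components `𝒬 n`, so homogeneous coactions
-- may be tested on pure tensors with first factor of degree `n ∈ ℕ^θ`.
include hV in
theorem coact_mem {γ : Γ} {v : V} (hv : v ∈ 𝒱 γ) {T : Submodule k (Q ⊗[k] V)}
    (hT : ∀ n γ', degreeMap ι n + γ' = γ → ∀ x ∈ 𝒬 n, ∀ w ∈ 𝒱 γ', x ⊗ₜ w ∈ T) :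
    Y.coact v ∈ T := by
  refine tensorGrading_le (fun γ₁ γ₂ hγ x hx w hw => ?_) (hV.coact_graded γ v hv)
  have : gradingAlong (degreeMap ι) 𝒬 γ₁ ≤ T.comap ((TensorProduct.mk k Q V).flip w) := by
    refine iSup₂_le fun n hn x hxn => ?_
    subst hn
    exact hT n γ₂ hγ x hxn w hw
  exact this hx

variable (hQ : DirectSum.IsInternal 𝒬)

section Slices

/-- The part of the coaction of degree `(n, γ)` only depends on the component of degree
`n + γ`. -/
theorem homogProj_slice_coact (n : Fin θ → ℕ) (γ : Γ) (φ : Q →ₗ[k] k) (v : V) :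
    homogProj hV.isGradedObject.1 γ (slice (φ ∘ₗ homogProj hQ n) (Y.coact v)) =
      homogProj hV.isGradedObject.1 γ (slice (φ ∘ₗ homogProj hQ n)
        (Y.coact (homogProj hV.isGradedObject.1 (degreeMap ι n + γ) v))) := by
  have h := hV.isGradedObject.1
  let L : V →ₗ[k] V := homogProj h γ ∘ₗ slice (φ ∘ₗ homogProj hQ n) ∘ₗ Y.coact
  change L v = L (homogProj h (degreeMap ι n + γ) v)
  refine induction_homogeneous h
    (LinearMap.eqLocus L (L ∘ₗ homogProj h (degreeMap ι n + γ))) (fun γ' v hv => ?_) v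
  change L v = L (homogProj h (degreeMap ι n + γ) v)
  by_cases hγ : γ' = degreeMap ι n + γ
  · subst hγ
    rw [homogProj_of_mem h hv]
  · rw [homogProj_of_mem_ne h hv hγ, map_zero]
    refine hV.coact_mem hv
      (T := LinearMap.ker (homogProj h γ ∘ₗ slice (φ ∘ₗ homogProj hQ n))) ?_
    intro m γ₂ hm x hx w hw
    rw [LinearMap.mem_ker, LinearMap.comp_apply, slice_tmul, map_smul, LinearMap.comp_apply]
    by_cases hmn : m = n
    · subst hmn
      rw [homogProj_of_mem_ne h hw, smul_zero]
      rintro rfl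
      exact hγ hm.symm
    · rw [homogProj_of_mem_ne hQ hx hmn, map_zero, zero_smul]

/-- On the component of degree `n + γ`, the part of the coaction in `Q ⊗ V(γ)` lies in
`Q(n) ⊗ V(γ)`. -/
theorem homogProj_slice_coact_of_mem (hι : Function.Injective ι) {n : Fin θ → ℕ} {γ : Γ}
    (φ : Q →ₗ[k] k) {v : V} (hv : v ∈ 𝒱 (degreeMap ι n + γ)) :
    homogProj hV.isGradedObject.1 γ (slice φ (Y.coact v)) =
      homogProj hV.isGradedObject.1 γ (slice (φ ∘ₗ homogProj hQ n) (Y.coact v)) := by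
  have h := hV.isGradedObject.1
  refine hV.coact_mem hv (T := LinearMap.eqLocus (homogProj h γ ∘ₗ slice φ)
    (homogProj h γ ∘ₗ slice (φ ∘ₗ homogProj hQ n))) ?_
  intro m γ₂ hm x hx w hw
  change homogProj h γ (slice φ (x ⊗ₜ w)) =
    homogProj h γ (slice (φ ∘ₗ homogProj hQ n) (x ⊗ₜ w))
  rw [slice_tmul, slice_tmul, map_smul, map_smul, LinearMap.comp_apply]
  by_cases hγ : γ₂ = γ
  · subst hγ
    rw [degreeMap_injective hι (add_right_cancel hm)] at hx
    rw [homogProj_of_mem hQ hx]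
  · rw [homogProj_of_mem_ne h hw hγ, smul_zero, smul_zero]

end Slices

section Generated

variable {γ₀ : Γ}

include hQ in
/-- A module generated in degree `γ₀` lives in the degrees `n + γ₀` with `n ∈ ℕ^θ`. -/
theorem homogProj_eq_zero_of_forall_ne (hgen : IsGeneratedBy Y (𝒱 γ₀)) {γ : Γ}
    (hγ : ∀ n, γ ≠ degreeMap ι n + γ₀) (v : V) : homogProj hV.isGradedObject.1 γ v = 0 := by
  have h := hV.isGradedObject.1
  let U : Submodule k V := ⨆ n, 𝒱 (degreeMap ι n + γ₀)
  have hle : ∀ n, 𝒱 (degreeMap ι n + γ₀) ≤ U := fun n =>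
    le_iSup (fun n => 𝒱 (degreeMap ι n + γ₀)) n
  have hU : U = ⊤ := by
    refine hgen U ?_ fun x u hu => ?_
    · have := hle 0
      rwa [degreeMap_zero, zero_add] at this
    · induction hu using Submodule.iSup_induction' with
      | mem n u hu =>
        refine act_mem_of_homogeneous hQ (fun m x hx => hle (m + n) ?_) x
        rw [degreeMap_add, add_assoc]
        exact hV.act_mem hx hu
      | zero => simp
      | add u u' _ _ hu hu' =>
        rw [TensorProduct.tmul_add, map_add]
        exact U.add_mem hu hu'
  have hker : U ≤ LinearMap.ker (homogProj h γ) :=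
    iSup_le fun n u hu => homogProj_of_mem_ne h hu (hγ n).symm
  exact hker (hU ▸ Submodule.mem_top)

include hQ in
/-- The sum of the components of degree different from `γ₀` is a `Q`-submodule. -/
theorem act_mem_ker_homogProj (hι : Function.Injective ι) (hgen : IsGeneratedBy Y (𝒱 γ₀))
    (x : Q) {v : V} (hv : v ∈ LinearMap.ker (homogProj hV.isGradedObject.1 γ₀)) :
    Y.act (x ⊗ₜ v) ∈ LinearMap.ker (homogProj hV.isGradedObject.1 γ₀) := by
  have h := hV.isGradedObject.1
  refine act_mem_of_homogeneous hQ (fun m x hx => ?_) x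
  refine mem_of_homogProj_mem h ((LinearMap.ker (homogProj h γ₀)).comap
    (Y.act ∘ₗ TensorProduct.mk k Q V x)) fun γ => ?_
  change Y.act (x ⊗ₜ homogProj h γ v) ∈ LinearMap.ker (homogProj h γ₀)
  by_cases hγ : ∃ n, γ = degreeMap ι n + γ₀
  · obtain ⟨n, rfl⟩ := hγ
    by_cases hn : n = 0
    · subst hn
      rw [degreeMap_zero, zero_add, LinearMap.mem_ker.1 hv]
      simp
    -- The product has degree `m + n + γ₀`, and `m + n = 0` in `ℕ^θ` would force `n = 0`.
    · refine homogProj_of_mem_ne h (hV.act_mem hx (homogProj_mem h _ v)) fun h0 => hn ?_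
      rw [← add_assoc, ← degreeMap_add, add_eq_right, ← degreeMap_zero ι] at h0
      have h1 := degreeMap_injective hι h0
      ext j
      have := congrFun h1 j
      simp at this ⊢
      omega
  · rw [homogProj_eq_zero_of_forall_ne hV hQ hgen (not_exists.1 hγ) v]
    simp

end Generated

end IsGradedYD

end GradedYD

/-! ### Stability of `Q ⊗ U` under tensor structures and braidings -/

section TensorStability

variable {k : Type u₀} [Field k] {H : Type u₁} [Ring H] [HopfAlgebra k H]
variable {Q : Type u₂} [AddCommGroup Q] [Module k Q]
variable {V : Type u₃} [AddCommGroup V] [Module k V]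
variable {XQ : ActCoact k H Q} {XV : ActCoact k H V} {U : Submodule k V}

/-- With `tensor_coact_mem` this makes `Q ⊗ U` a subobject of `Q ⊗ V`. It is applied to `U = ker
π₀`. -/
theorem ActCoact.IsSub.tensor_act_mem (hU : XV.IsSub U) (a : H) {t : Q ⊗[k] V}
    (ht : t ∈ LinearMap.range (LinearMap.lTensor Q U.subtype)) :
    (XQ.tensor XV).act (a ⊗ₜ t) ∈ LinearMap.range (LinearMap.lTensor Q U.subtype) := by
  refine map_mem_of_tmul ((XQ.tensor XV).act ∘ₗ TensorProduct.mk k H (Q ⊗[k] V) a) _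
    (fun q u hu => ?_) ht
  exact map_mem_of_forall_tmul (TensorProduct.map XQ.act XV.act ∘ₗ
    (TensorProduct.tensorTensorTensorComm k H H Q V).toLinearMap ∘ₗ
    (TensorProduct.mk k (H ⊗[k] H) (Q ⊗[k] V)).flip (q ⊗ₜ u)) _
    (fun b c => by simpa using tmul_mem_range_lTensor _ (hU.1 c u hu)) (Coalgebra.comul a)

theorem ActCoact.IsSub.tensor_coact_mem (hU : XV.IsSub U) {t : Q ⊗[k] V}
    (ht : t ∈ LinearMap.range (LinearMap.lTensor Q U.subtype)) :
    (XQ.tensor XV).coact t ∈ LinearMap.range (LinearMap.lTensor H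
      (LinearMap.range (LinearMap.lTensor Q U.subtype)).subtype) := by
  refine map_mem_of_tmul _ _ (fun q u hu => ?_) ht
  let g : (H ⊗[k] Q) ⊗[k] (H ⊗[k] V) →ₗ[k] H ⊗[k] (Q ⊗[k] V) :=
    LinearMap.rTensor (Q ⊗[k] V) (LinearMap.mul' k H) ∘ₗ
      (TensorProduct.tensorTensorTensorComm k H Q H V).toLinearMap
  change g (XQ.coact q ⊗ₜ XV.coact u) ∈ _
  refine map_mem_of_forall_tmul (g ∘ₗ (TensorProduct.mk k _ _).flip (XV.coact u)) _
    (fun a q' => ?_) (XQ.coact q)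
  refine map_mem_of_tmul (g ∘ₗ TensorProduct.mk k _ _ (a ⊗ₜ q')) _ (fun b u' hu' => ?_) (hU.2 u hu)
  simpa [g] using tmul_mem_range_lTensor (a * b) (tmul_mem_range_lTensor q' hu')

/-- The braiding `c_{Q,V}` maps `Q ⊗ U` to `U ⊗ Q`. -/
theorem ActCoact.IsSub.braiding_left_mem (hU : XV.IsSub U) {X : Type u₄} [AddCommGroup X]
    [Module k X] (g : V ⊗[k] Q →ₗ[k] X) (T : Submodule k X) (hg : ∀ u ∈ U, ∀ q, g (u ⊗ₜ q) ∈ T)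
    (q : Q) {u : V} (hu : u ∈ U) : g (XQ.braiding XV (q ⊗ₜ u)) ∈ T := by
  have := map_mem_of_forall_tmul (g ∘ₗ LinearMap.rTensor Q XV.act ∘ₗ
    (TensorProduct.assoc k H V Q).symm.toLinearMap ∘ₗ
    LinearMap.lTensor H (TensorProduct.comm k Q V).toLinearMap ∘ₗ
    (TensorProduct.assoc k H Q V).toLinearMap ∘ₗ (TensorProduct.mk k _ _).flip u) T
    (fun a q' => by simpa using hg _ (hU.1 a u hu) q') (XQ.coact q)
  simpa [ActCoact.braiding] using this

/-- The braiding `c_{V,Q}` maps `U ⊗ Q` to `Q ⊗ U`. -/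
theorem ActCoact.IsSub.braiding_right_mem (hU : XV.IsSub U) (q : Q) {u : V} (hu : u ∈ U) :
    XV.braiding XQ (u ⊗ₜ q) ∈ LinearMap.range (LinearMap.lTensor Q U.subtype) := by
  have := map_mem_of_tmul (LinearMap.rTensor V XQ.act ∘ₗ
    (TensorProduct.assoc k H Q V).symm.toLinearMap ∘ₗ
    LinearMap.lTensor H (TensorProduct.comm k V Q).toLinearMap ∘ₗ
    (TensorProduct.assoc k H V Q).toLinearMap ∘ₗ (TensorProduct.mk k _ _).flip q)
    (LinearMap.range (LinearMap.lTensor Q U.subtype))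
    (fun a u' hu' => by simpa using tmul_mem_range_lTensor _ hu') (hU.2 u hu)
  simpa [ActCoact.braiding] using this

end TensorStability

/-! ### Coaction on products with a primitive element -/

section Primitive

variable {k : Type u₀} [Field k] {H : Type u₁} [Ring H] [HopfAlgebra k H]
variable {Q : Type u₂} [Ring Q] [Algebra k Q] [Coalgebra k Q] {S : Q →ₗ[k] Q}
variable {V : Type u₃} [AddCommGroup V] [Module k V]
variable {XQ : ActCoact k H Q} {XV : ActCoact k H V} {Y : ActCoact k Q V}

theorem IsHopfAlgebra.coact_one (hQ : IsHopfAlgebra XQ S) : XQ.coact 1 = 1 ⊗ₜ 1 := by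
  have := LinearMap.congr_fun hQ.unit_hom.2 1
  simpa [ActCoact.unit] using this

theorem IsHopfAlgebra.act_one (hQ : IsHopfAlgebra XQ S) (a : H) :
    XQ.act (a ⊗ₜ 1) = Coalgebra.counit (R := k) a • (1 : Q) := by
  have := LinearMap.congr_fun hQ.unit_hom.1 (a ⊗ₜ 1)
  simpa [ActCoact.unit, Algebra.algebraMap_eq_smul_one] using this.symm

theorem IsHopfAlgebra.braiding_one_left (hQ : IsHopfAlgebra XQ S) (hV : XV.IsModule) (v : V) :
    XQ.braiding XV (1 ⊗ₜ v) = v ⊗ₜ 1 := by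
  simp [ActCoact.braiding, hQ.coact_one, hV.1]

/-- `H` acts on `1` through its counit, so the counit axiom of the comodule `V` collapses `v₋₁ · 1 ⊗
v₀` to `1 ⊗ v`. -/
theorem IsHopfAlgebra.braiding_one_right (hQ : IsHopfAlgebra XQ S) (hV : XV.IsComodule) (v : V) :
    XV.braiding XQ (v ⊗ₜ 1) = 1 ⊗ₜ v := by
  have key : ∀ t : H ⊗[k] V, LinearMap.rTensor V XQ.act
      ((TensorProduct.assoc k H Q V).symm
        (LinearMap.lTensor H (TensorProduct.comm k V Q).toLinearMap
          (TensorProduct.assoc k H V Q (t ⊗ₜ (1 : Q))))) =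
      1 ⊗ₜ slice (Coalgebra.counit (R := k) (A := H)) t := by
    intro t
    induction t with
    | zero => simp
    | tmul a w => simp [hQ.act_one, TensorProduct.smul_tmul]
    | add s t hs ht => simp only [TensorProduct.add_tmul, map_add, hs, ht, TensorProduct.tmul_add]
  have h2 : slice (Coalgebra.counit (R := k) (A := H)) (XV.coact v) = v := by
    rw [slice, LinearMap.comp_apply, hV.1 v]
    simp
  have := key (XV.coact v)
  rw [h2] at this
  simpa [ActCoact.braiding] using this

/-- If `K` is a subobject in `𝒞` and a subcomodule that lies in a `Q`-submodule `P`, then for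
primitive `x` the coaction maps `x · K` to `Q ⊗ P`. -/
theorem coact_act_mem_of_primitive (hQ : IsHopfAlgebra XQ S) (hV : IsYDOver XQ XV Y)
    {K P : Submodule k V} (hK : XV.IsSub K)
    (hKcoact : ∀ v ∈ K, Y.coact v ∈ LinearMap.range (LinearMap.lTensor Q K.subtype))
    (hKP : K ≤ P) (hP : ∀ (x : Q), ∀ v ∈ P, Y.act (x ⊗ₜ v) ∈ P) {x : Q}
    (hx : Coalgebra.comul (R := k) x = x ⊗ₜ[k] 1 + 1 ⊗ₜ[k] x) {v : V} (hv : v ∈ K) :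
    Y.coact (Y.act (x ⊗ₜ v)) ∈ LinearMap.range (LinearMap.lTensor Q P.subtype) := by
  have hcompat := LinearMap.congr_fun hV.compat (x ⊗ₜ v)
  -- `(μ ⊗ id)(id ⊗ c_{V,Q})`
  let R : (Q ⊗[k] V) ⊗[k] Q →ₗ[k] Q ⊗[k] V :=
    LinearMap.rTensor V (LinearMap.mul' k Q) ∘ₗ
      (TensorProduct.assoc k Q Q V).symm.toLinearMap ∘ₗ
      LinearMap.lTensor Q (XV.braiding XQ) ∘ₗ
      (TensorProduct.assoc k Q V Q).toLinearMap
  have hR1 : ∀ t : Q ⊗[k] V, R (t ⊗ₜ 1) = t := by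
    intro t
    induction t with
    | zero => simp
    | tmul q w => simp [R, hQ.braiding_one_right hV.isYD.isComodule]
    | add s t hs ht => rw [TensorProduct.add_tmul, map_add, hs, ht]
  have hRK : ∀ t ∈ LinearMap.range (LinearMap.lTensor Q K.subtype), ∀ q,
      R (t ⊗ₜ q) ∈ LinearMap.range (LinearMap.lTensor Q K.subtype) := by
    intro t ht q
    refine map_mem_of_tmul (R ∘ₗ (TensorProduct.mk k _ _).flip q) _ (fun q' u hu => ?_) ht
    exact map_mem_of_tmul (LinearMap.rTensor V (LinearMap.mul' k Q) ∘ₗ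
      (TensorProduct.assoc k Q Q V).symm.toLinearMap ∘ₗ TensorProduct.mk k Q _ q') _
      (fun q'' u' hu' => by simpa using tmul_mem_range_lTensor _ hu')
      (hK.braiding_right_mem q hu)
  -- Primitivity plays no role on this side: `δ(v) ∈ Q ⊗ K`, the braiding acts only on the
  -- `Q`-factors, and then an element of `Q` acts on `K ⊆ P`.
  have hlhs : TensorProduct.map (LinearMap.mul' k Q) Y.act (midBraid (XQ.braiding XQ)
      (Coalgebra.comul (R := k) x ⊗ₜ Y.coact v)) ∈
      LinearMap.range (LinearMap.lTensor Q P.subtype) := by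
    refine map_mem_of_forall_tmul (TensorProduct.map (LinearMap.mul' k Q) Y.act ∘ₗ
      midBraid (XQ.braiding XQ) ∘ₗ (TensorProduct.mk k _ _).flip (Y.coact v)) _ (fun a b => ?_) _
    refine map_mem_of_tmul (TensorProduct.map (LinearMap.mul' k Q) Y.act ∘ₗ
      midBraid (XQ.braiding XQ) ∘ₗ TensorProduct.mk k _ _ (a ⊗ₜ b)) _ (fun q u hu => ?_)
      (hKcoact v hv)
    have := map_mem_of_forall_tmul (TensorProduct.map (LinearMap.mul' k Q) Y.act ∘ₗ
      (TensorProduct.assoc k Q Q (Q ⊗[k] V)).symm.toLinearMap ∘ₗ TensorProduct.mk k Q _ a ∘ₗ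
      (TensorProduct.assoc k Q Q V).toLinearMap ∘ₗ (TensorProduct.mk k _ V).flip u)
      (LinearMap.range (LinearMap.lTensor Q P.subtype))
      (fun c d => by simpa using tmul_mem_range_lTensor _ (hP d u (hKP hu)))
      (XQ.braiding XQ (b ⊗ₜ q))
    simpa [midBraid] using this
  -- `(δ ν ⊗ id)` followed by `R`, on `1 ⊗ V ⊗ Q`
  let g : V ⊗[k] Q →ₗ[k] Q ⊗[k] V :=
    R ∘ₗ LinearMap.rTensor Q (Y.coact ∘ₗ Y.act) ∘ₗ
      (TensorProduct.assoc k Q V Q).symm.toLinearMap ∘ₗ TensorProduct.mk k Q _ 1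
  have hg : g (XQ.braiding XV (x ⊗ₜ v)) ∈ LinearMap.range (LinearMap.lTensor Q P.subtype) := by
    refine hK.braiding_left_mem g _ (fun u hu q => ?_) x hv
    refine range_lTensor_mono hKP ?_
    simpa [g, hV.isModule.1] using hRK _ (hKcoact u hu) q
  -- The summand `x ⊗ 1` of the coproduct yields `δ(x · v)`, since braiding with `1` is the flip;
  -- the summand `1 ⊗ x` yields the term with `g`.
  have hrhs : TensorProduct.map (LinearMap.mul' k Q) Y.act (midBraid (XQ.braiding XQ)
      (Coalgebra.comul (R := k) x ⊗ₜ Y.coact v)) =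
      Y.coact (Y.act (x ⊗ₜ v)) + g (XQ.braiding XV (x ⊗ₜ v)) := by
    refine hcompat.trans ?_
    rw [← hR1 (Y.coact (Y.act (x ⊗ₜ v)))]
    simp [g, R, hx, TensorProduct.add_tmul, hQ.braiding_one_left hV.isYD.isModule]
  rw [hrhs] at hlhs
  exact (Submodule.add_mem_iff_left _ hg).1 hlhs

end Primitive

/-- A subobject that meets `V(γ₀)` non-trivially is everything. -/
theorem eq_top_of_inf_ne_bot {k : Type u₀} [Field k] {H : Type u₁} [Ring H] [HopfAlgebra k H]
    {Q : Type u₂} [Ring Q] [Algebra k Q] {V : Type u₃} [AddCommGroup V] [Module k V]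
    {Γ : Type u₅} [DecidableEq Γ] {XV : ActCoact k H V} {Y : ActCoact k Q V}
    {𝒱 : Γ → Submodule k V} {γ₀ : Γ} (hgen : IsGeneratedBy Y (𝒱 γ₀))
    (hirr : IsIrreducibleComponent XV (𝒱 γ₀)) (hV : IsGradedObject XV 𝒱) {U : Submodule k V}
    (hU : IsSubobject XV Y U) (hne : U ⊓ 𝒱 γ₀ ≠ ⊥) : U = ⊤ :=
  hgen U (inf_eq_right.1
    ((hirr.2 _ inf_le_right (hU.1.inf (hV.2 γ₀))).resolve_left hne)) hU.2.1

/-! ### The kernel as a graded subobject, and the irreducibility criterion -/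

section Main

variable {k : Type u₀} [Field k] {H : Type u₁} [Ring H] [HopfAlgebra k H]
variable {Q : Type u₂} [Ring Q] [Algebra k Q] [Coalgebra k Q] {θ : ℕ}
variable {XQ : ActCoact k H Q} {S : Q →ₗ[k] Q} {𝒬 : (Fin θ → ℕ) → Submodule k Q}
variable {N : Fin θ → Submodule k Q}
variable {Γ : Type u₅} [AddCommGroup Γ] [DecidableEq Γ] {ι : (Fin θ → ℤ) →+ Γ}
variable {V : Type u₃} [AddCommGroup V] [Module k V]
variable {XV : ActCoact k H V} {Y : ActCoact k Q V} {𝒱 : Γ → Submodule k V} {γ₀ : Γ}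

namespace IsGradedYD

variable (hV : IsGradedYD XQ (gradingAlong (degreeMap ι) 𝒬) XV Y 𝒱)

/-- The kernel of the Shapovalov morphism is a subobject in `𝒞`. -/
theorem isSub_ker_shapovalov :
    XV.IsSub (LinearMap.ker (shapovalov Y 𝒱 hV.isGradedObject.1 γ₀)) := by
  have hP := hV.isGradedObject.isSub_ker_homogProj γ₀
  refine ⟨fun a u hu => ?_, fun u hu => ?_⟩
  · rw [mem_ker_shapovalov_iff_coact_mem] at hu ⊢
    have := LinearMap.congr_fun hV.isYDOver.coact_hom.1 (a ⊗ₜ u)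
    simp only [LinearMap.comp_apply, LinearMap.lTensor_tmul] at this
    rw [this]
    exact hP.tensor_act_mem a hu
  · rw [mem_ker_shapovalov_iff_coact_mem] at hu
    rw [mem_range_lTensor_iff]
    intro φ
    rw [mem_ker_shapovalov_iff_coact_mem]
    have h1 := (mem_range_lTensor_iff _ _).1 (hP.tensor_coact_mem (XQ := XQ) hu) φ
    have h2 := LinearMap.congr_fun hV.isYDOver.coact_hom.2 u
    simp only [LinearMap.comp_apply] at h2
    rwa [h2, slice_lTensor] at h1

/-- The kernel of the Shapovalov morphism is a subcomodule. -/
theorem coact_mem_ker_shapovalov {v : V}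
    (hv : v ∈ LinearMap.ker (shapovalov Y 𝒱 hV.isGradedObject.1 γ₀)) :
    Y.coact v ∈ LinearMap.range (LinearMap.lTensor Q
      (LinearMap.ker (shapovalov Y 𝒱 hV.isGradedObject.1 γ₀)).subtype) := by
  rw [mem_ker_shapovalov_iff_coact_mem] at hv
  rw [mem_range_lTensor_iff]
  intro φ
  rw [mem_ker_shapovalov_iff_coact_mem]
  have h2 := LinearMap.congr_fun hV.isYDOver.isComodule.2 v
  simp only [LinearMap.comp_apply, LinearEquiv.coe_coe] at h2
  -- By coassociativity, the coaction of a slice of `δ(v)` is a slice of `(Δ ⊗ id) δ(v)`, where the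
  -- factor in `ker π₀` is untouched.
  rw [← slice_lTensor, ← h2]
  refine map_mem_of_tmul (slice φ ∘ₗ (TensorProduct.assoc k Q Q V).toLinearMap ∘ₗ
    LinearMap.rTensor V (Coalgebra.comul (R := k) (A := Q))) _ (fun q u hu => ?_) hv
  refine map_mem_of_forall_tmul (slice φ ∘ₗ (TensorProduct.assoc k Q Q V).toLinearMap ∘ₗ
    (TensorProduct.mk k _ V).flip u) _ (fun a b => ?_) (Coalgebra.comul (R := k) q)
  simpa using Submodule.smul_mem _ (φ a) (tmul_mem_range_lTensor b hu)

theorem ker_shapovalov_le :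
    LinearMap.ker (shapovalov Y 𝒱 hV.isGradedObject.1 γ₀) ≤
      LinearMap.ker (homogProj hV.isGradedObject.1 γ₀) := fun _ hv =>
  homogProj_eq_zero_of_mem_ker hV.isYDOver.isComodule _ hv

/-- The kernel of the Shapovalov morphism is a `Q`-submodule. -/
theorem act_mem_ker_shapovalov (hQ : IsPreNicholsSystem XQ S 𝒬 N) (hι : Function.Injective ι)
    (hgen : IsGeneratedBy Y (𝒱 γ₀)) (x : Q) :
    ∀ v ∈ LinearMap.ker (shapovalov Y 𝒱 hV.isGradedObject.1 γ₀),
      Y.act (x ⊗ₜ v) ∈ LinearMap.ker (shapovalov Y 𝒱 hV.isGradedObject.1 γ₀) := by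
  have hx : x ∈ Algebra.adjoin k (⋃ i, (N i : Set Q)) := by rw [hQ.generates]; trivial
  induction hx using Algebra.adjoin_induction with
  | mem x hx =>
    obtain ⟨i, hi⟩ := Set.mem_iUnion.1 hx
    intro v hv
    rw [mem_ker_shapovalov_iff_coact_mem]
    -- Applied with `K = ker f_V` and `P = ker π₀`.
    exact coact_act_mem_of_primitive hQ.isGradedHopfAlgebra.isHopfAlgebra hV.isYDOver
      hV.isSub_ker_shapovalov (fun v hv => hV.coact_mem_ker_shapovalov hv) hV.ker_shapovalov_le
      (fun x v hv => hV.act_mem_ker_homogProj hQ.isGradedHopfAlgebra.isGradedObject.1 hι hgen x hv)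
      (hQ.comul_eq hi) hv
  | algebraMap c =>
    intro v hv
    rw [Algebra.algebraMap_eq_smul_one, ← TensorProduct.smul_tmul', map_smul,
      hV.isYDOver.isModule.1]
    exact Submodule.smul_mem _ c hv
  | add x y _ _ hx hy =>
    intro v hv
    rw [TensorProduct.add_tmul, map_add]
    exact Submodule.add_mem _ (hx v hv) (hy v hv)
  | mul x y _ _ hx hy =>
    intro v hv
    rw [hV.isYDOver.isModule.2]
    exact hx _ (hy v hv)

/-- As `δ` is graded, `f_V` of the component of `v` in degree `n + γ₀` is the part of `f_V(v)` in
`Q(n) ⊗ V(γ₀)`, so it vanishes with `f_V(v)`. -/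
theorem homogProj_mem_ker_shapovalov (hQ : DirectSum.IsInternal 𝒬) (hι : Function.Injective ι)
    (hgen : IsGeneratedBy Y (𝒱 γ₀)) {v : V}
    (hv : v ∈ LinearMap.ker (shapovalov Y 𝒱 hV.isGradedObject.1 γ₀)) (γ : Γ) :
    homogProj hV.isGradedObject.1 γ v ∈
      LinearMap.ker (shapovalov Y 𝒱 hV.isGradedObject.1 γ₀) := by
  by_cases hγ : ∃ n, γ = degreeMap ι n + γ₀
  · obtain ⟨n, rfl⟩ := hγ
    rw [mem_ker_shapovalov_iff] at hv ⊢
    intro φ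
    rw [hV.homogProj_slice_coact_of_mem hQ hι φ (homogProj_mem _ _ v),
      ← hV.homogProj_slice_coact hQ]
    exact hv _
  · rw [hV.homogProj_eq_zero_of_forall_ne hQ hgen (not_exists.1 hγ)]
    exact zero_mem _

theorem isGradedSubobject_ker_shapovalov (hQ : IsPreNicholsSystem XQ S 𝒬 N)
    (hι : Function.Injective ι) (hgen : IsGeneratedBy Y (𝒱 γ₀)) :
    IsGradedSubobject XV Y 𝒱 (LinearMap.ker (shapovalov Y 𝒱 hV.isGradedObject.1 γ₀)) := by
  refine ⟨⟨hV.isSub_ker_shapovalov, fun x v hv => hV.act_mem_ker_shapovalov hQ hι hgen x v hv,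
    fun v hv => hV.coact_mem_ker_shapovalov hv⟩,
    le_antisymm (fun v hv => ?_) (iSup_le fun γ => inf_le_left)⟩
  refine mem_of_homogProj_mem hV.isGradedObject.1 _ fun γ => ?_
  exact (le_iSup (fun γ => LinearMap.ker (shapovalov Y 𝒱 hV.isGradedObject.1 γ₀) ⊓ 𝒱 γ) γ)
    ⟨hV.homogProj_mem_ker_shapovalov hQ.isGradedHopfAlgebra.isGradedObject.1 hι hgen hv γ,
      homogProj_mem _ γ v⟩

/-- Gradedness of `U` is what turns `U ∩ V(γ₀) = 0` into `U ⊆ ker π₀`. -/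
theorem le_ker_shapovalov_of_isGradedSubobject (hgen : IsGeneratedBy Y (𝒱 γ₀))
    (hirr : IsIrreducibleComponent XV (𝒱 γ₀)) {U : Submodule k V}
    (hU : IsGradedSubobject XV Y 𝒱 U) (hne : U ≠ ⊤) :
    U ≤ LinearMap.ker (shapovalov Y 𝒱 hV.isGradedObject.1 γ₀) := by
  have hbot : U ⊓ 𝒱 γ₀ = ⊥ := by
    by_contra h
    exact hne (eq_top_of_inf_ne_bot hgen hirr hV.isGradedObject hU.1 h)
  refine le_ker_shapovalov hV.isGradedObject.1 hU.1.2 (hU.2.le.trans (iSup_le fun γ v hv => ?_))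
  by_cases hγ : γ = γ₀
  · subst hγ
    rw [hbot] at hv
    rw [(Submodule.mem_bot k).1 hv]
    exact zero_mem _
  · exact homogProj_of_mem_ne _ hv.2 hγ

theorem ker_shapovalov_eq_bot_of_isIrreducible (hQ : IsPreNicholsSystem XQ S 𝒬 N)
    (hι : Function.Injective ι) (hgen : IsGeneratedBy Y (𝒱 γ₀)) (hne : 𝒱 γ₀ ≠ ⊥)
    (hirr : IsIrreducible XV Y) :
    LinearMap.ker (shapovalov Y 𝒱 hV.isGradedObject.1 γ₀) = ⊥ := by
  refine (hirr.2 _ (hV.isGradedSubobject_ker_shapovalov hQ hι hgen).1).resolve_right fun htop => ?_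
  obtain ⟨v, hv, hv0⟩ := Submodule.exists_mem_ne_zero_of_ne_bot hne
  apply hv0
  rw [← homogProj_of_mem hV.isGradedObject.1 hv]
  exact hV.ker_shapovalov_le (htop ▸ Submodule.mem_top)

/-- If the Shapovalov morphism is injective, then every non-zero subobject, graded or not, meets
`V(γ₀)`: take the part of the coaction of maximal degree in `Q`. -/
theorem inf_ne_bot_of_ker_shapovalov_eq_bot (hQ : DirectSum.IsInternal 𝒬)
    (hι : Function.Injective ι) (hgen : IsGeneratedBy Y (𝒱 γ₀))
    (hker : LinearMap.ker (shapovalov Y 𝒱 hV.isGradedObject.1 γ₀) = ⊥) {U : Submodule k V}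
    (hU : Y.IsSub U) (hne : U ≠ ⊥) : U ⊓ 𝒱 γ₀ ≠ ⊥ := by
  have h := hV.isGradedObject.1
  obtain ⟨u, hu, hu0⟩ := Submodule.exists_mem_ne_zero_of_ne_bot hne
  let s : Set (Fin θ → ℕ) := {n | homogProj h (degreeMap ι n + γ₀) u ≠ 0}
  have hsfin : s.Finite := by
    obtain ⟨t, ht, -⟩ := exists_finset_sum_homogProj h u
    refine Set.Finite.of_finite_image (f := fun n => degreeMap ι n + γ₀)
      (t.finite_toSet.subset ?_) fun m _ n _ hmn => degreeMap_injective hι (add_right_cancel hmn)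
    rintro _ ⟨n, hn, rfl⟩
    exact ht _ hn
  have hsne : s.Nonempty := by
    by_contra hs
    apply hu0
    refine (Submodule.mem_bot k).1 (mem_of_homogProj_mem h ⊥ fun γ => (Submodule.mem_bot k).2 ?_)
    by_cases hγ : ∃ n, γ = degreeMap ι n + γ₀
    · obtain ⟨n, rfl⟩ := hγ
      by_contra hn
      exact hs ⟨n, hn⟩
    · exact hV.homogProj_eq_zero_of_forall_ne hQ hgen (not_exists.1 hγ) u
  -- Maximal for the componentwise partial order on `ℕ^θ`.
  obtain ⟨n, hn⟩ := hsfin.exists_maximal hsne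
  have hnot : homogProj h (degreeMap ι n + γ₀) u ∉
      LinearMap.ker (shapovalov Y 𝒱 hV.isGradedObject.1 γ₀) := by
    rw [hker]
    exact hn.prop
  rw [mem_ker_shapovalov_iff] at hnot
  push Not at hnot
  obtain ⟨φ, hφ⟩ := hnot
  -- The component of `u` need not lie in `U`. Restricting `φ` to `Q(n)` allows `u` itself to be
  -- sliced instead, which keeps the result in `U`.
  rw [hV.homogProj_slice_coact_of_mem hQ hι φ (homogProj_mem _ _ u),
    ← hV.homogProj_slice_coact hQ] at hφ
  let w := slice (φ ∘ₗ homogProj hQ n) (Y.coact u)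
  -- The component of `w` in degree `m + γ₀` comes from that of `u` in degree `n + m + γ₀`, which is
  -- zero for `m ≠ 0` by maximality of `n`.
  have hw : homogProj h γ₀ w = w := by
    refine homogProj_eq_self h fun γ hγ => ?_
    by_cases hγ' : ∃ m, γ = degreeMap ι m + γ₀
    · obtain ⟨m, rfl⟩ := hγ'
      have hm : m ≠ 0 := by
        rintro rfl
        exact hγ (by rw [degreeMap_zero, zero_add])
      have hz : homogProj h (degreeMap ι n + (degreeMap ι m + γ₀)) u = 0 := by
        rw [← add_assoc, ← degreeMap_add]
        by_contra hnm
        have hle : n + m ≤ n := hn.le_of_ge hnm (le_add_of_nonneg_right zero_le)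
        apply hm
        ext j
        have := hle j
        simp at this
        simp [this]
      rw [hV.homogProj_slice_coact hQ, hz]
      simp
    · exact hV.homogProj_eq_zero_of_forall_ne hQ hgen (not_exists.1 hγ') w
  refine (Submodule.ne_bot_iff _).2 ⟨w, ⟨(mem_range_lTensor_iff _ _).1 (hU.2 u hu) _, ?_⟩, ?_⟩
  · rw [← hw]
    exact homogProj_mem h γ₀ w
  · rw [← hw]
    exact hφ

theorem isIrreducible_iff (hQ : IsPreNicholsSystem XQ S 𝒬 N)
    (hι : Function.Injective ι) (hgen : IsGeneratedBy Y (𝒱 γ₀))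
    (hirr : IsIrreducibleComponent XV (𝒱 γ₀)) :
    IsIrreducible XV Y ↔ LinearMap.ker (shapovalov Y 𝒱 hV.isGradedObject.1 γ₀) = ⊥ := by
  refine ⟨hV.ker_shapovalov_eq_bot_of_isIrreducible hQ hι hgen hirr.1, fun hker =>
    ⟨fun h => hirr.1 (le_bot_iff.1 (h ▸ le_top)), fun U hU => or_iff_not_imp_left.2 fun hne => ?_⟩⟩
  exact eq_top_of_inf_ne_bot hgen hirr hV.isGradedObject hU
    (hV.inf_ne_bot_of_ker_shapovalov_eq_bot hQ.isGradedHopfAlgebra.isGradedObject.1 hι hgen hker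
      hU.2 hne)

end IsGradedYD

end Main

end YDNichols

end

theorem mainTheorem3 {k H Q V Γ : Type*}
    [Field k] [Ring H] [HopfAlgebra k H]
    (hH : Function.Bijective (HopfAlgebra.antipode k (A := H)))
    [Ring Q] [Algebra k Q] [Coalgebra k Q] {θ : ℕ}
    (XQ : YDNichols.ActCoact k H Q) (S : Q →ₗ[k] Q)
    (𝒬 : (Fin θ → ℕ) → Submodule k Q) (N : Fin θ → Submodule k Q)
    (hQ : YDNichols.IsPreNicholsSystem XQ S 𝒬 N)
    [AddCommGroup Γ] [DecidableEq Γ]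
    (ι : (Fin θ → ℤ) →+ Γ) (hι : Function.Injective ι)
    [AddCommGroup V] [Module k V]
    (XV : YDNichols.ActCoact k H V) (Y : YDNichols.ActCoact k Q V) (𝒱 : Γ → Submodule k V)
    (hV : YDNichols.IsGradedYD XQ (YDNichols.gradingAlong (YDNichols.degreeMap ι) 𝒬) XV Y 𝒱)
    (γ₀ : Γ) (hgen : YDNichols.IsGeneratedBy Y (𝒱 γ₀))
    (hirr : YDNichols.IsIrreducibleComponent XV (𝒱 γ₀)) :
    YDNichols.IsGradedSubobject XV Y 𝒱
        (LinearMap.ker (YDNichols.shapovalov Y 𝒱 hV.isGradedObject.1 γ₀)) ∧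
      (∀ U : Submodule k V, YDNichols.IsGradedSubobject XV Y 𝒱 U → U ≠ ⊤ →
        U ≤ LinearMap.ker (YDNichols.shapovalov Y 𝒱 hV.isGradedObject.1 γ₀)) ∧
      (YDNichols.IsIrreducible XV Y ↔
        LinearMap.ker (YDNichols.shapovalov Y 𝒱 hV.isGradedObject.1 γ₀) = ⊥) :=
  ⟨hV.isGradedSubobject_ker_shapovalov hQ hι hgen,
    fun _ hU hne => hV.le_ker_shapovalov_of_isGradedSubobject hgen hirr hU hne,
    hV.isIrreducible_iff hQ hι hgen hirr⟩
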